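/- Let $m\in\mathbb{R}^d$, let $S$ be a symmetric positive definite real $d\times d$ matrix, and let $\widehat\xi_1,\widehat\xi_2,\dots$ be independent random vectors in $\mathbb{R}^d$, each with the Gaussian distribution $\mathcal N(m,S)$. For $n\ge 1$ let $$\widehat\mu_n=\frac1n\sum_{t=1}^n\widehat\xi_t,\qquad \widehat\Sigma_n=\frac1n\sum_{t=1}^n(\widehat\xi_t-\widehat\mu_n)(\widehat\xi_t-\widehat\mu_n)^\top$$ be the sample mean and the sample covariance matrix. Let $\mathrm{KL}(\mathbb Q_1\,\|\,\mathbb Q_2)=\mathbb{E}_{\mathbb Q_1}[\log(\mathrm d\mathbb Q_1/\mathrm d\mathbb Q_2)]$ denote the Kullback–Leibler divergence if $\mathbb Q_1\ll\mathbb Q_2$, with $\mathrm{KL}(\mathbb Q_1\,\|\,\mathbb Q_2)=+\infty$ otherwise (so it is $+\infty$ when $\mathbb Q_1=\mathcal N(\widehat\mu_n,\widehat\Sigma_n)$ with $\widehat\Sigma_n$ singular and $\mathbb Q_2=\mathcal N(m,S)$). Then, as $n\to\infty$, the $[0,+\infty]$-valued random variables $$n\cdot \mathrm{KL}\big(\mathcal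 N(\widehat\mu_n,\widehat\Sigma_n)\,\big\|\,\mathcal N(m,S)\big)$$ converge in distribution to $\tfrac12\chi^2\big(d(d+3)/2\big)$, that is, to one half of a random variable that has the chi-square distribution with $d(d+3)/2$ degrees of freedom. -/

import Mathlib

open MeasureTheory ProbabilityTheory InformationTheory Filter
open scoped ENNReal

/-- The sample mean of the first `n` points of the sequence `x` in `ℝ^d`. -/
noncomputable def sampleMean {d : ℕ} (n : ℕ) (x : ℕ → EuclideanSpace ℝ (Fin d)) :
    EuclideanSpace ℝ (Fin d) :=
  (n : ℝ)⁻¹ • ∑ t ∈ Finset.range n, x t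

/-- The sample covariance matrix (with normalization `1 / n`) of the first `n` points of the
sequence `x` in `ℝ^d`. -/
noncomputable def sampleCov {d : ℕ} (n : ℕ) (x : ℕ → EuclideanSpace ℝ (Fin d)) :
    Matrix (Fin d) (Fin d) ℝ :=
  (n : ℝ)⁻¹ • ∑ t ∈ Finset.range n,
    Matrix.vecMulVec (x t - sampleMean n x).ofLp (x t - sampleMean n x).ofLp

/-- The chi-square distribution with `k` degrees of freedom: the law of the sum of the squares of
`k` independent standard normal random variables. -/
noncomputable def chiSquare (k : ℕ) : Measure ℝ :=
  (Measure.pi fun _ : Fin k ↦ gaussianReal 0 1).map fun z ↦ ∑ i, z i ^ 2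

instance isProbabilityMeasure_chiSquare (k : ℕ) : IsProbabilityMeasure (chiSquare k) :=
  Measure.isProbabilityMeasure_map (Measurable.aemeasurable (by fun_prop))

/-! ### Gaussian densities and affine changes of variables -/

section GaussianDensity

variable {ι : Type*} [Fintype ι]

/-! Invertible affine maps preserve the divergence and carry fitted Gaussians to fitted Gaussians
(`exists_map_stdGaussian_eq`), so the data may be taken standard normal. With sample mean `a` and
sample covariance `1 + H`, twice the divergence is `‖a‖² + tr H - log det (1 + H)`, and for small
symmetric `H` the last two terms equal `‖H‖²/2` (Frobenius norm) up to a factor tending to 1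
(`abs_logDetError_le`).

Up to the correction `-a aᵀ`, the pair `(a, H)` is an average of the normalized Hermite polynomials
of degree one and two. These `d + d + d(d-1)/2 = d(d+3)/2` functions are centered and orthonormal
under the standard Gaussian, and in these coordinates `‖a‖² + ‖H‖²/2`, without the correction, is
exactly a sum of squares (`sum_sq_hermiteIndex`). The central limit theorem sends `√n` times the
average to a standard Gaussian vector, whose squared norm is chi-square.

By the strong law the unscaled average tends to 0 almost surely. This makes the correction and the
expansion error negligible (Slutsky), and makes the covariance eventually nonsingular, so the
infinite values do not affect the limit. -/

lemma pi_gaussianReal_eq_withDensity :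
    Measure.pi (fun _ : ι ↦ gaussianReal 0 1) =
      (volume : Measure (ι → ℝ)).withDensity
        fun x ↦ ENNReal.ofReal (∏ i, gaussianPDFReal 0 1 (x i)) := by
  classical
  refine Measure.pi_eq fun s hs ↦ ?_
  rw [withDensity_apply _ (MeasurableSet.univ_pi hs), volume_pi, Measure.restrict_pi_pi,
    ← ofReal_integral_eq_lintegral_ofReal, integral_fintype_prod_eq_prod (𝕜 := ℝ),
    ENNReal.ofReal_prod_of_nonneg]
  · simp_rw [gaussianReal_apply_eq_integral 0 one_ne_zero]
  · exact fun i _ ↦ integral_nonneg fun x ↦ gaussianPDFReal_nonneg _ _ _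
  · exact Integrable.fintype_prod (𝕜 := ℝ) fun i ↦ (integrable_gaussianPDFReal 0 1).integrableOn
  · exact ae_of_all _ fun x ↦ Finset.prod_nonneg fun i _ ↦ gaussianPDFReal_nonneg _ _ _

/-- The density of the standard Gaussian distribution with respect to the Lebesgue measure. -/
noncomputable def stdGaussianPDF (x : EuclideanSpace ℝ ι) : ℝ :=
  (√(2 * Real.pi))⁻¹ ^ Fintype.card ι * Real.exp (-‖x‖ ^ 2 / 2)

lemma stdGaussianPDF_pos (x : EuclideanSpace ℝ ι) : 0 < stdGaussianPDF x := by
  unfold stdGaussianPDF; positivity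

lemma measurable_stdGaussianPDF : Measurable (stdGaussianPDF (ι := ι)) := by
  unfold stdGaussianPDF; fun_prop

lemma stdGaussian_eq_withDensity :
    stdGaussian (EuclideanSpace ℝ ι) =
      volume.withDensity fun x ↦ ENNReal.ofReal (stdGaussianPDF x) := by
  have hm := measurable_stdGaussianPDF (ι := ι)
  rw [← map_pi_eq_stdGaussian, pi_gaussianReal_eq_withDensity]
  have hmap := (PiLp.volume_preserving_toLp ι).map_eq
  refine Measure.ext_of_lintegral _ fun f hf ↦ ?_
  have hf' : Measurable fun x : ι → ℝ ↦ f (WithLp.toLp 2 x) := hf.comp (by fun_prop)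
  have hg : Measurable fun x : ι → ℝ ↦ ENNReal.ofReal (∏ i, gaussianPDFReal 0 1 (x i)) :=
    Measurable.ennreal_ofReal (Finset.measurable_prod _ fun i _ ↦
      (measurable_gaussianPDFReal 0 1).comp (measurable_pi_apply i))
  rw [lintegral_map hf (by fun_prop), lintegral_withDensity_eq_lintegral_mul _ hg hf',
    lintegral_withDensity_eq_lintegral_mul _ (by fun_prop) hf, ← hmap,
    lintegral_map (by fun_prop) (by fun_prop)]
  congr with x
  simp only [Pi.mul_apply]
  congr 2
  simp [stdGaussianPDF, gaussianPDFReal, Finset.prod_mul_distrib, ← Real.exp_sum,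
    EuclideanSpace.real_norm_sq_eq, Finset.sum_div, neg_div]

lemma stdGaussian_absolutelyContinuous_volume :
    stdGaussian (EuclideanSpace ℝ ι) ≪ volume := by
  rw [stdGaussian_eq_withDensity]
  exact withDensity_absolutelyContinuous _ _

variable [DecidableEq ι]

lemma det_toEuclideanCLM (B : Matrix ι ι ℝ) :
    LinearMap.det (Matrix.toEuclideanCLM (𝕜 := ℝ) B : EuclideanSpace ℝ ι →ₗ[ℝ] EuclideanSpace ℝ ι)
      = B.det := by
  rw [Matrix.coe_toEuclideanCLM_eq_toEuclideanLin, Matrix.toEuclideanLin,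
    Matrix.toLpLin_eq_toLin 2 2, LinearMap.det_toLin]

lemma toEuclideanCLM_inv_apply_self {B : Matrix ι ι ℝ} (hB : B.det ≠ 0)
    (x : EuclideanSpace ℝ ι) :
    Matrix.toEuclideanCLM (𝕜 := ℝ) B⁻¹ (Matrix.toEuclideanCLM (𝕜 := ℝ) B x) = x := by
  rw [← mul_apply_eq_comp, ← map_mul, Matrix.nonsing_inv_mul _ (by simpa using hB)]
  simp

lemma toEuclideanCLM_apply_inv_self {B : Matrix ι ι ℝ} (hB : B.det ≠ 0)
    (x : EuclideanSpace ℝ ι) :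
    Matrix.toEuclideanCLM (𝕜 := ℝ) B (Matrix.toEuclideanCLM (𝕜 := ℝ) B⁻¹ x) = x := by
  rw [← mul_apply_eq_comp, ← map_mul, Matrix.mul_nonsing_inv _ (by simpa using hB)]
  simp

/-- The invertible affine map `x ↦ a + B x` as a measurable equivalence. -/
noncomputable def affineMeasurableEquiv (a : EuclideanSpace ℝ ι) (B : Matrix ι ι ℝ)
    (hB : B.det ≠ 0) : EuclideanSpace ℝ ι ≃ᵐ EuclideanSpace ℝ ι where
  toFun x := a + Matrix.toEuclideanCLM (𝕜 := ℝ) B x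
  invFun y := Matrix.toEuclideanCLM (𝕜 := ℝ) B⁻¹ (y - a)
  left_inv x := by simp [toEuclideanCLM_inv_apply_self hB]
  right_inv y := by simp [toEuclideanCLM_apply_inv_self hB]
  measurable_toFun := by simp only [Equiv.coe_fn_mk]; fun_prop
  measurable_invFun := by simp only [Equiv.coe_fn_symm_mk]; fun_prop

/-- The density of the image of the standard Gaussian distribution under `x ↦ a + B x` with respect
to the standard Gaussian distribution. -/
noncomputable def affineDensity (a : EuclideanSpace ℝ ι) (B : Matrix ι ι ℝ)
    (x : EuclideanSpace ℝ ι) : ℝ :=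
  |B.det|⁻¹ * Real.exp ((‖x‖ ^ 2 - ‖Matrix.toEuclideanCLM (𝕜 := ℝ) B⁻¹ (x - a)‖ ^ 2) / 2)

lemma measurable_affineDensity (a : EuclideanSpace ℝ ι) (B : Matrix ι ι ℝ) :
    Measurable (affineDensity a B) := by
  unfold affineDensity; fun_prop

lemma map_affine_volume (a : EuclideanSpace ℝ ι) {B : Matrix ι ι ℝ} (hB : B.det ≠ 0) :
    (volume : Measure (EuclideanSpace ℝ ι)).map
      (fun x ↦ a + Matrix.toEuclideanCLM (𝕜 := ℝ) B x) = ENNReal.ofReal |B.det|⁻¹ • volume := by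
  have h : (fun x ↦ a + Matrix.toEuclideanCLM (𝕜 := ℝ) B x) =
    (fun x ↦ a + x) ∘ (Matrix.toEuclideanCLM (𝕜 := ℝ) B) := rfl
  rw [h, ← Measure.map_map (by fun_prop) (by fun_prop)]
  have := Measure.map_linearMap_addHaar_eq_smul_addHaar
    (volume : Measure (EuclideanSpace ℝ ι))
    (f := (Matrix.toEuclideanCLM (𝕜 := ℝ) B : EuclideanSpace ℝ ι →ₗ[ℝ] EuclideanSpace ℝ ι))
    (by rwa [det_toEuclideanCLM])
  rw [det_toEuclideanCLM, ContinuousLinearMap.coe_coe] at this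
  rw [this, Measure.map_smul, map_add_left_eq_self, abs_inv]

/-- Change of variables on test functions: the Jacobian and the ratio of the two Gaussian densities
combine into `affineDensity`. -/
lemma map_affine_stdGaussian (a : EuclideanSpace ℝ ι) {B : Matrix ι ι ℝ} (hB : B.det ≠ 0) :
    (stdGaussian (EuclideanSpace ℝ ι)).map (fun x ↦ a + Matrix.toEuclideanCLM (𝕜 := ℝ) B x) =
      (stdGaussian (EuclideanSpace ℝ ι)).withDensity
        fun x ↦ ENNReal.ofReal (affineDensity a B x) := by
  have hm := measurable_stdGaussianPDF (ι := ι)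
  have hd := measurable_affineDensity a B
  refine Measure.ext_of_lintegral _ fun f hf ↦ ?_
  have hT : Measurable fun x : EuclideanSpace ℝ ι ↦ a + Matrix.toEuclideanCLM (𝕜 := ℝ) B x := by
    fun_prop
  have hfT : Measurable fun x : EuclideanSpace ℝ ι ↦
      f (a + Matrix.toEuclideanCLM (𝕜 := ℝ) B x) := hf.comp hT
  rw [lintegral_map hf hT,
    lintegral_withDensity_eq_lintegral_mul _ (by fun_prop) hf, stdGaussian_eq_withDensity,
    lintegral_withDensity_eq_lintegral_mul _ (by fun_prop) hfT,
    lintegral_withDensity_eq_lintegral_mul _ (by fun_prop) (by fun_prop)]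
  -- The integrand in the variable `y = a + B x`.
  let F : EuclideanSpace ℝ ι → ℝ≥0∞ := fun y ↦
    ENNReal.ofReal (stdGaussianPDF (Matrix.toEuclideanCLM (𝕜 := ℝ) B⁻¹ (y - a))) * f y
  have hF : Measurable F := by fun_prop
  calc _ = ∫⁻ x, F (a + Matrix.toEuclideanCLM (𝕜 := ℝ) B x) := by
        simp [F, toEuclideanCLM_inv_apply_self hB]
    _ = ∫⁻ y, F y ∂((volume : Measure (EuclideanSpace ℝ ι)).map
          (fun x ↦ a + Matrix.toEuclideanCLM (𝕜 := ℝ) B x)) := (lintegral_map hF hT).symm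
    _ = ENNReal.ofReal |B.det|⁻¹ * ∫⁻ y, F y := by
        rw [map_affine_volume a hB, lintegral_smul_measure, smul_eq_mul]
    _ = _ := by
        rw [← lintegral_const_mul _ hF]
        congr with y
        simp only [F, Pi.mul_apply, ← mul_assoc]
        rw [← ENNReal.ofReal_mul (by positivity), ← ENNReal.ofReal_mul (stdGaussianPDF_pos y).le]
        congr 2
        simp only [stdGaussianPDF, affineDensity]
        rw [mul_mul_mul_comm, ← Real.exp_add]
        rw [mul_left_comm, ← mul_assoc]
        congr 2
        ring

end GaussianDensity

/-! ### Divergence of a Gaussian from the standard Gaussian -/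

section KLGaussian

open scoped MatrixOrder

/-- The data processing inequality, applied to `e` and to its inverse. -/
lemma klDiv_map_measurableEquiv {α β : Type*} [MeasurableSpace α] [MeasurableSpace β]
    (μ ν : Measure α) [IsFiniteMeasure μ] [IsFiniteMeasure ν] (e : α ≃ᵐ β) :
    klDiv (μ.map e) (ν.map e) = klDiv μ ν := by
  refine le_antisymm (klDiv_map_le μ ν e.measurable) ?_
  simpa using klDiv_map_le (μ.map e) (ν.map e) e.symm.measurable

variable {ι : Type*} [Fintype ι] [DecidableEq ι]

lemma integrable_norm_sq_toEuclideanCLM_stdGaussian (B : Matrix ι ι ℝ) :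
    Integrable (fun x ↦ ‖Matrix.toEuclideanCLM (𝕜 := ℝ) B x‖ ^ 2)
      (stdGaussian (EuclideanSpace ℝ ι)) := by
  have h : MemLp (fun x ↦ Matrix.toEuclideanCLM (𝕜 := ℝ) B x) 2
      (stdGaussian (EuclideanSpace ℝ ι)) :=
    (Matrix.toEuclideanCLM (𝕜 := ℝ) B).comp_memLp' IsGaussian.memLp_two_id
  exact h.integrable_norm_pow two_ne_zero

lemma integral_strongDual_sq_stdGaussian {E : Type*} [NormedAddCommGroup E]
    [InnerProductSpace ℝ E] [FiniteDimensional ℝ E] [MeasurableSpace E] [BorelSpace E]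
    (L : StrongDual ℝ E) : ∫ x, L x ^ 2 ∂(stdGaussian E) = ‖L‖ ^ 2 := by
  rw [← variance_dual_stdGaussian, variance_of_integral_eq_zero (by fun_prop)
    (integral_strongDual_stdGaussian L)]

/-- Each coordinate of `B x` is the functional given by a row of `B`, and its second moment is the
squared norm of that row. -/
lemma integral_norm_sq_toEuclideanCLM_stdGaussian (B : Matrix ι ι ℝ) :
    ∫ x, ‖Matrix.toEuclideanCLM (𝕜 := ℝ) B x‖ ^ 2 ∂(stdGaussian (EuclideanSpace ℝ ι)) =
      ∑ i, ∑ j, B i j ^ 2 := by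
  have h (x : EuclideanSpace ℝ ι) : ‖Matrix.toEuclideanCLM (𝕜 := ℝ) B x‖ ^ 2 =
      ∑ i, innerSL ℝ (WithLp.toLp 2 (B i) : EuclideanSpace ℝ ι) x ^ 2 := by
    rw [EuclideanSpace.real_norm_sq_eq]
    refine Finset.sum_congr rfl fun i _ ↦ ?_
    rw [Matrix.ofLp_toEuclideanCLM, innerSL_apply_apply, EuclideanSpace.inner_eq_star_dotProduct]
    simp [Matrix.mulVec, dotProduct_comm]
  simp_rw [h]
  rw [integral_finsetSum]
  · refine Finset.sum_congr rfl fun i _ ↦ ?_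
    rw [integral_strongDual_sq_stdGaussian, innerSL_apply_norm, EuclideanSpace.real_norm_sq_eq]
  · intro i _
    exact ((innerSL ℝ (WithLp.toLp 2 (B i) : EuclideanSpace ℝ ι)).comp_memLp'
      IsGaussian.memLp_two_id).integrable_sq

/-- Pulled back along `T`, the log-density is a quadratic polynomial in a standard Gaussian vector:
the linear term has mean zero and the squares have known second moments. -/
lemma klDiv_map_affine_stdGaussian (a : EuclideanSpace ℝ ι) {B : Matrix ι ι ℝ}
    (hB : B.det ≠ 0) :
    klDiv ((stdGaussian (EuclideanSpace ℝ ι)).map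
        fun x ↦ a + Matrix.toEuclideanCLM (𝕜 := ℝ) B x) (stdGaussian (EuclideanSpace ℝ ι)) =
      ENNReal.ofReal ((‖a‖ ^ 2 + ∑ i, ∑ j, B i j ^ 2 - Fintype.card ι) / 2 -
        Real.log |B.det|) := by
  set γ := stdGaussian (EuclideanSpace ℝ ι) with hγ
  set T : EuclideanSpace ℝ ι → EuclideanSpace ℝ ι :=
    fun x ↦ a + Matrix.toEuclideanCLM (𝕜 := ℝ) B x with hT
  have hTm : Measurable T := by fun_prop
  have hd := measurable_affineDensity a B
  have hdens : γ.map T = γ.withDensity fun x ↦ ENNReal.ofReal (affineDensity a B x) :=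
    map_affine_stdGaussian a hB
  have hprob : IsProbabilityMeasure (γ.map T) := Measure.isProbabilityMeasure_map hTm.aemeasurable
  have hac : γ.map T ≪ γ := by
    rw [hdens]; exact withDensity_absolutelyContinuous _ _
  have hpos (x) : 0 < affineDensity a B x := by unfold affineDensity; positivity
  have hllr : llr (γ.map T) γ =ᵐ[γ.map T] fun x ↦ Real.log (affineDensity a B x) := by
    refine hac.ae_le ?_
    have := Measure.rnDeriv_withDensity γ (f := fun x ↦ ENNReal.ofReal (affineDensity a B x))
      (by fun_prop)
    rw [← hdens] at this
    filter_upwards [this] with x hx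
    rw [llr, hx, ENNReal.toReal_ofReal (hpos x).le]
  -- `‖x‖` is written with the identity matrix so that the second-moment lemma applies to both
  -- squares.
  have hlog (x) : Real.log (affineDensity a B (T x)) =
      (‖a‖ ^ 2 / 2 - Real.log |B.det|) + (innerSL ℝ a ∘L Matrix.toEuclideanCLM (𝕜 := ℝ) B) x +
        (‖Matrix.toEuclideanCLM (𝕜 := ℝ) B x‖ ^ 2 -
        ‖Matrix.toEuclideanCLM (𝕜 := ℝ) (1 : Matrix ι ι ℝ) x‖ ^ 2) / 2 := by
    rw [affineDensity, Real.log_mul (by positivity) (by positivity), Real.log_inv, Real.log_exp]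
    simp only [hT, add_sub_cancel_left, toEuclideanCLM_inv_apply_self hB, map_one]
    rw [norm_add_sq_real]
    simp
    ring
  have hi1 : Integrable (fun x ↦ (innerSL ℝ a ∘L Matrix.toEuclideanCLM (𝕜 := ℝ) B) x) γ :=
    (ContinuousLinearMap.comp_memLp' _ IsGaussian.memLp_two_id).integrable (by norm_num)
  have hiB := integrable_norm_sq_toEuclideanCLM_stdGaussian B
  have hi1' := integrable_norm_sq_toEuclideanCLM_stdGaussian (1 : Matrix ι ι ℝ)
  have hi2 : Integrable (fun x ↦ (‖Matrix.toEuclideanCLM (𝕜 := ℝ) B x‖ ^ 2 -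
      ‖Matrix.toEuclideanCLM (𝕜 := ℝ) (1 : Matrix ι ι ℝ) x‖ ^ 2) / 2) γ :=
    (hiB.sub hi1').div_const 2
  have hi3 : Integrable (fun x ↦ (‖a‖ ^ 2 / 2 - Real.log |B.det|) +
      (innerSL ℝ a ∘L Matrix.toEuclideanCLM (𝕜 := ℝ) B) x) γ := (integrable_const _).add hi1
  have hint : Integrable (llr (γ.map T) γ) (γ.map T) := by
    rw [integrable_congr hllr,
      integrable_map_measure hd.log.aestronglyMeasurable hTm.aemeasurable]
    simp only [Function.comp_def, hlog]
    exact hi3.add hi2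
  rw [klDiv_of_ac_of_integrable hac hint, integral_congr_ae hllr,
    integral_map hTm.aemeasurable hd.log.aestronglyMeasurable]
  simp_rw [hlog]
  rw [integral_add hi3 hi2, integral_add (integrable_const _) hi1, integral_div,
    integral_sub hiB hi1', integral_norm_sq_toEuclideanCLM_stdGaussian,
    integral_norm_sq_toEuclideanCLM_stdGaussian, integral_strongDual_stdGaussian]
  simp [Matrix.one_apply]
  ring_nf

lemma sq_det_sqrt {S : Matrix ι ι ℝ} (hS : S.PosSemidef) : (CFC.sqrt S).det ^ 2 = S.det := by
  rw [sq, ← Matrix.det_mul, CFC.sqrt_mul_sqrt_self S hS.nonneg]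

lemma isSymm_sqrt (S : Matrix ι ι ℝ) : (CFC.sqrt S).IsSymm := by
  simpa [Matrix.IsHermitian, Matrix.IsSymm, Matrix.conjTranspose_eq_transpose_of_trivial] using
    (Matrix.nonneg_iff_posSemidef.1 (CFC.sqrt_nonneg S)).isHermitian

lemma sum_sq_sqrt {S : Matrix ι ι ℝ} (hS : S.PosSemidef) :
    ∑ i, ∑ j, (CFC.sqrt S) i j ^ 2 = S.trace := by
  conv_rhs => rw [← CFC.sqrt_mul_sqrt_self S hS.nonneg]
  simp only [Matrix.trace, Matrix.diag, Matrix.mul_apply]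
  refine Finset.sum_congr rfl fun i _ ↦ Finset.sum_congr rfl fun j _ ↦ ?_
  rw [(isSymm_sqrt S).apply i j, sq]

lemma klDiv_multivariateGaussian_stdGaussian (a : EuclideanSpace ℝ ι) {S : Matrix ι ι ℝ}
    (hS : S.PosSemidef) (hdet : S.det ≠ 0) :
    klDiv (multivariateGaussian a S) (stdGaussian (EuclideanSpace ℝ ι)) =
      ENNReal.ofReal ((‖a‖ ^ 2 + (S.trace - Fintype.card ι - Real.log S.det)) / 2) := by
  have hB : (CFC.sqrt S).det ≠ 0 := by
    intro h; rw [← sq_det_sqrt hS, h] at hdet; simp at hdet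
  rw [multivariateGaussian, klDiv_map_affine_stdGaussian a hB, sum_sq_sqrt hS, ← sq_det_sqrt hS,
    Real.log_pow, Real.log_abs]
  congr 1
  push_cast
  ring

/-- A kernel vector `v` of the symmetric root is orthogonal to its range, so the degenerate Gaussian
lives on the hyperplane through `a` normal to `v`. That hyperplane is Lebesgue-null, so absolute
continuity fails. -/
lemma klDiv_multivariateGaussian_stdGaussian_of_det_eq_zero (a : EuclideanSpace ℝ ι)
    {S : Matrix ι ι ℝ} (hS : S.PosSemidef) (hdet : S.det = 0) :
    klDiv (multivariateGaussian a S) (stdGaussian (EuclideanSpace ℝ ι)) = ∞ := by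
  have hB : (CFC.sqrt S).det = 0 := by
    rw [← sq_det_sqrt hS] at hdet; simpa using hdet
  obtain ⟨v, hv, hBv⟩ := Matrix.exists_mulVec_eq_zero_iff.2 hB
  let L : StrongDual ℝ (EuclideanSpace ℝ ι) := innerSL ℝ (WithLp.toLp 2 v)
  have hL : L ≠ 0 := by
    intro h
    apply hv
    have := congrArg norm h
    simpa [L] using this
  let H : Set (EuclideanSpace ℝ ι) := {x | L x = L a}
  have hHm : MeasurableSet H := measurableSet_eq_fun (by fun_prop) (by fun_prop)
  refine klDiv_of_not_ac fun hac ↦ ?_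
  have h0 : stdGaussian (EuclideanSpace ℝ ι) H = 0 := by
    refine stdGaussian_absolutelyContinuous_volume ?_
    have hH : H = (AffineSubspace.mk' a (LinearMap.ker (L : EuclideanSpace ℝ ι →ₗ[ℝ] ℝ)) :
        Set (EuclideanSpace ℝ ι)) := by
      ext x
      simp [H, AffineSubspace.mem_mk', sub_eq_zero]
    rw [hH]
    refine Measure.addHaar_affineSubspace _ _ fun h ↦ hL ?_
    have := congrArg AffineSubspace.direction h
    rw [AffineSubspace.direction_mk', AffineSubspace.direction_top, LinearMap.ker_eq_top] at this
    exact_mod_cast this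
  have h1 : multivariateGaussian a S H = 1 := by
    rw [multivariateGaussian, Measure.map_apply (by fun_prop) hHm]
    convert measure_univ (μ := stdGaussian (EuclideanSpace ℝ ι))
    refine Set.eq_univ_of_forall fun x ↦ ?_
    have : L (Matrix.toEuclideanCLM (𝕜 := ℝ) (CFC.sqrt S) x) = 0 := by
      rw [innerSL_apply_apply, Matrix.inner_toEuclideanCLM, Matrix.dotProduct_mulVec,
        ← Matrix.mulVec_transpose, (isSymm_sqrt S).eq, hBv, zero_dotProduct]
    simp [H, this]
  simpa [h1] using hac h0

end KLGaussian

/-! ### Second-order expansion of the log-determinant -/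

section LogDetExpansion

variable {ι : Type*} [Fintype ι] [DecidableEq ι]

lemma abs_log_one_add_sub_le {x : ℝ} (hx : |x| ≤ 1 / 2) :
    |x - Real.log (1 + x) - x ^ 2 / 2| ≤ 2 * |x| ^ 3 := by
  have h := Real.abs_log_sub_add_sum_range_le (x := -x) (by rw [abs_neg]; linarith) 2
  rw [Finset.sum_range_succ, Finset.sum_range_one] at h
  norm_num at h
  -- The remainder of the logarithmic series has denominator `1 - |x| ≥ 1/2`.
  have h2 : |x| ^ 3 / (1 - |x|) ≤ 2 * |x| ^ 3 := by
    rw [div_le_iff₀ (by linarith)]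
    nlinarith [pow_nonneg (abs_nonneg x) 3]
  rw [← abs_neg, show -(x - Real.log (1 + x) - x ^ 2 / 2) = -x + x ^ 2 / 2 + Real.log (1 + x) by
    ring]
  exact h.trans h2

/-- For small symmetric `H`, `tr H - log det (1 + H)` is half the squared Frobenius norm of `H`
up to a cubic error. -/
lemma abs_trace_sub_log_det_sub_le {H : Matrix ι ι ℝ} (hH : H.IsSymm)
    (hQ : ∑ i, ∑ j, H i j ^ 2 ≤ 1 / 4) :
    0 < (1 + H).det ∧ |H.trace - Real.log (1 + H).det - (∑ i, ∑ j, H i j ^ 2) / 2| ≤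
      2 * √(∑ i, ∑ j, H i j ^ 2) * ∑ i, ∑ j, H i j ^ 2 := by
  have hH' : H.IsHermitian := by
    simpa [Matrix.IsHermitian, Matrix.IsSymm, Matrix.conjTranspose_eq_transpose_of_trivial] using hH
  set l := hH'.eigenvalues with hl
  have htr : H.trace = ∑ i, l i := by simpa using hH'.trace_eq_sum_eigenvalues
  -- Diagonalization reduces the claim to the scalar estimate, summed over the eigenvalues.
  obtain ⟨U, V, hUV, hVU, hspec⟩ : ∃ U V : Matrix ι ι ℝ, U * V = 1 ∧ V * U = 1 ∧
      H = U * Matrix.diagonal l * V := by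
    refine ⟨hH'.eigenvectorUnitary, star (hH'.eigenvectorUnitary : Matrix ι ι ℝ), ?_, ?_, ?_⟩
    · exact Unitary.coe_mul_star_self _
    · exact Unitary.coe_star_mul_self _
    · conv_lhs => rw [hH'.spectral_theorem, Unitary.conjStarAlgAut_apply]
      rfl
  have hdet : (1 + H).det = ∏ i, (1 + l i) := by
    have : 1 + H = U * (Matrix.diagonal fun i ↦ 1 + l i) * V := by
      rw [← Matrix.diagonal_add, Matrix.diagonal_one, mul_add, mul_one, add_mul, hUV, ← hspec]
    rw [this, Matrix.det_mul_comm, ← mul_assoc, hVU, one_mul, Matrix.det_diagonal]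
  have hsq : ∑ i, ∑ j, H i j ^ 2 = ∑ i, l i ^ 2 := by
    have h1 : ∑ i, ∑ j, H i j ^ 2 = (H * H).trace := by
      simp only [Matrix.trace, Matrix.diag, Matrix.mul_apply]
      refine Finset.sum_congr rfl fun i _ ↦ Finset.sum_congr rfl fun j _ ↦ ?_
      rw [hH.apply i j, sq]
    have h2 : H * H = U * (Matrix.diagonal fun i ↦ l i ^ 2) * V := by
      calc H * H = U * (Matrix.diagonal l * (V * U) * Matrix.diagonal l) * V := by
            conv_lhs => rw [hspec]
            simp only [mul_assoc]
        _ = _ := by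
            rw [hVU, mul_one, Matrix.diagonal_mul_diagonal]
            simp only [sq]
    rw [h1, h2, Matrix.trace_mul_comm, ← mul_assoc, hVU, one_mul, Matrix.trace_diagonal]
  rw [hsq] at hQ ⊢
  have hle (i) : |l i| ≤ √(∑ i, l i ^ 2) :=
    Real.abs_le_sqrt (Finset.single_le_sum (f := fun i ↦ l i ^ 2) (fun i _ ↦ sq_nonneg _)
      (Finset.mem_univ i))
  -- The bound `1/4` on the squared norm puts every eigenvalue in the range of the scalar estimate.
  have hhalf : √(∑ i, l i ^ 2) ≤ 1 / 2 := by
    rw [Real.sqrt_le_left (by norm_num)]; linarith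
  have hpos (i) : 0 < 1 + l i := by
    have := (abs_le.1 ((hle i).trans hhalf)).1
    linarith
  refine ⟨hdet ▸ Finset.prod_pos fun i _ ↦ hpos i, ?_⟩
  rw [htr, hdet, Real.log_prod fun i _ ↦ (hpos i).ne', ← Finset.sum_sub_distrib, Finset.sum_div,
    ← Finset.sum_sub_distrib, Finset.mul_sum]
  refine (Finset.abs_sum_le_sum_abs _ _).trans (Finset.sum_le_sum fun i _ ↦ ?_)
  refine (abs_log_one_add_sub_le ((hle i).trans hhalf)).trans ?_
  -- One factor of `|l i| ^ 3` is bounded by the Frobenius norm; the other two remain in the sum.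
  rw [← sq_abs (l i), mul_assoc]
  gcongr
  rw [pow_succ']
  gcongr
  exact hle i

/-- The relative error of the second-order expansion of `tr H - log det (1 + H)`. -/
noncomputable def logDetError (H : Matrix ι ι ℝ) : ℝ :=
  if ∑ i, ∑ j, H i j ^ 2 = 0 then 0
  else 2 * (H.trace - Real.log (1 + H).det) / (∑ i, ∑ j, H i j ^ 2) - 1

lemma abs_logDetError_le {H : Matrix ι ι ℝ} (hH : H.IsSymm)
    (hQ : ∑ i, ∑ j, H i j ^ 2 ≤ 1 / 4) : |logDetError H| ≤ 4 * √(∑ i, ∑ j, H i j ^ 2) := by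
  unfold logDetError
  split_ifs with h
  · simp
  · have h0 : 0 < ∑ i, ∑ j, H i j ^ 2 :=
      lt_of_le_of_ne (Finset.sum_nonneg fun i _ ↦ Finset.sum_nonneg fun j _ ↦ sq_nonneg _)
        (Ne.symm h)
    have h1 := (abs_trace_sub_log_det_sub_le hH hQ).2
    set Q := ∑ i, ∑ j, H i j ^ 2
    have h2 : 2 * (H.trace - Real.log (1 + H).det) / Q - 1 =
        2 * (H.trace - Real.log (1 + H).det - Q / 2) / Q := by field_simp
    rw [h2, abs_div, abs_mul, abs_of_pos h0, div_le_iff₀ h0]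
    simp only [Nat.abs_ofNat]
    linarith

/-- Exact for every `H`: the value 0 of `logDetError` at `H = 0` costs nothing. The multiplicative
form lets `n` be absorbed by the quadratic factor alone. -/
lemma trace_sub_log_det_eq (H : Matrix ι ι ℝ) :
    H.trace - Real.log (1 + H).det = (∑ i, ∑ j, H i j ^ 2) * (1 + logDetError H) / 2 := by
  unfold logDetError
  split_ifs with h
  · have hH : H = 0 := by
      ext i j
      have h1 := (Finset.sum_eq_zero_iff_of_nonneg
        fun i _ ↦ Finset.sum_nonneg fun j _ ↦ sq_nonneg _).1 h i (Finset.mem_univ i)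
      have h2 := (Finset.sum_eq_zero_iff_of_nonneg fun j _ ↦ sq_nonneg _).1 h1 j
        (Finset.mem_univ j)
      simpa using h2
    simp [hH]
  · field_simp
    ring

end LogDetExpansion

/-! ### Gaussian moments and one-dimensional Hermite polynomials -/

section GaussianMoments

lemma integral_pow_gaussianReal_zero_one (n : ℕ) :
    ∫ x, x ^ n ∂(gaussianReal 0 1) = iteratedDeriv n (fun t ↦ Real.exp (t ^ 2 / 2)) 0 := by
  have h := iteratedDeriv_mgf_zero (X := id) (μ := gaussianReal 0 1)
    (by simp [integrableExpSet_id_gaussianReal]) n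
  rw [mgf_id_gaussianReal] at h
  simpa using h.symm

/-- Derivatives of the moment generating function stay of the form polynomial times `exp (t² / 2)`;
this is the recursion on the polynomial. -/
lemma deriv_mul_exp_sq_div_two {p p' : ℝ → ℝ} (hp : ∀ t, HasDerivAt p (p' t) t) :
    deriv (fun t ↦ p t * Real.exp (t ^ 2 / 2)) =
      fun t ↦ (p' t + t * p t) * Real.exp (t ^ 2 / 2) := by
  ext t
  have h1 : HasDerivAt (fun t : ℝ ↦ t ^ 2 / 2) t t :=
    ((hasDerivAt_pow 2 t).div_const 2).congr_deriv (by norm_num)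
  refine ((hp t).mul h1.exp).deriv.trans ?_
  ring

lemma integral_pow_two_gaussianReal : ∫ x, x ^ 2 ∂(gaussianReal 0 1) = 1 := by
  rw [← variance_of_integral_eq_zero (by fun_prop) (by simp)]
  simp

lemma gaussianReal_moments :
    ∫ x, x ^ 3 ∂(gaussianReal 0 1) = 0 ∧ ∫ x, x ^ 4 ∂(gaussianReal 0 1) = 3 := by
  have h0 : (fun t : ℝ ↦ Real.exp (t ^ 2 / 2)) = fun t ↦ 1 * Real.exp (t ^ 2 / 2) := by simp
  have h1 := deriv_mul_exp_sq_div_two fun t ↦ hasDerivAt_const t (1 : ℝ)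
  -- Each polynomial is kept as the previous derivative produces it, so that `simp only` can chain
  -- the four rules.
  have h2 := deriv_mul_exp_sq_div_two (p := fun t ↦ 0 + t * 1) (p' := fun _ ↦ 1) fun t ↦ by
    simpa using hasDerivAt_id' t
  have h3 := deriv_mul_exp_sq_div_two (p := fun t ↦ 1 + t * (0 + t * 1)) (p' := fun t ↦ 2 * t)
    fun t ↦ by
      have e : (fun t : ℝ ↦ 1 + t * (0 + t * 1)) = fun t ↦ 1 + t ^ 2 := by ext; ring
      rw [e]
      exact ((hasDerivAt_pow 2 t).const_add 1).congr_deriv (by norm_num)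
  have h4 := deriv_mul_exp_sq_div_two (p := fun t ↦ 2 * t + t * (1 + t * (0 + t * 1)))
    (p' := fun t ↦ 3 + 3 * t ^ 2) fun t ↦ by
      have e : (fun t : ℝ ↦ 2 * t + t * (1 + t * (0 + t * 1))) = fun t ↦ 3 * t + t ^ 3 := by
        ext; ring
      rw [e]
      exact (((hasDerivAt_id' t).const_mul 3).add (hasDerivAt_pow 3 t)).congr_deriv
        (by norm_num)
  rw [integral_pow_gaussianReal_zero_one, integral_pow_gaussianReal_zero_one, h0]
  simp only [iteratedDeriv_succ, iteratedDeriv_zero, h1, h2, h3, h4]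
  norm_num

/-- The normalized Hermite polynomials of degree at most two. -/
noncomputable def hermiteFun : Fin 3 → ℝ → ℝ :=
  ![fun _ ↦ 1, fun x ↦ x, fun x ↦ (x ^ 2 - 1) / √2]

@[fun_prop]
lemma measurable_hermiteFun (k : Fin 3) : Measurable (hermiteFun k) := by
  fin_cases k <;> simp only [hermiteFun] <;> simp <;> fun_prop

lemma integrable_pow_gaussianReal (n : ℕ) : Integrable (fun x ↦ x ^ n) (gaussianReal 0 1) :=
  integrable_pow_of_mem_interior_integrableExpSet (X := id)
    (by simp [integrableExpSet_id_gaussianReal]) n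

lemma memLp_hermiteFun (k : Fin 3) : MemLp (hermiteFun k) 2 (gaussianReal 0 1) := by
  refine (memLp_two_iff_integrable_sq (measurable_hermiteFun k).aestronglyMeasurable).2 ?_
  fin_cases k
  · simp [hermiteFun]
  · simpa [hermiteFun] using integrable_pow_gaussianReal 2
  · have h : (fun x ↦ hermiteFun 2 x ^ 2) = fun x : ℝ ↦ (x ^ 4 - 2 * x ^ 2 + 1) / 2 := by
      ext x
      simp only [hermiteFun, Matrix.cons_val, div_pow]
      rw [Real.sq_sqrt (by norm_num)]
      ring
    change Integrable (fun x ↦ hermiteFun 2 x ^ 2) _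
    rw [h]
    exact (((integrable_pow_gaussianReal 4).sub
      ((integrable_pow_gaussianReal 2).const_mul 2)).add (integrable_const 1)).div_const 2

/-- Products of two Hermite polynomials of degree at most two have degree at most four, so this
evaluates all nine inner products. -/
lemma integral_quartic_gaussianReal (a b c p q : ℝ) :
    ∫ x, (a + b * x ^ 1 + c * x ^ 2 + p * x ^ 3 + q * x ^ 4) ∂(gaussianReal 0 1) =
      a + c + 3 * q := by
  have hi (n : ℕ) (r : ℝ) : Integrable (fun x ↦ r * x ^ n) (gaussianReal 0 1) :=
    (integrable_pow_gaussianReal n).const_mul r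
  have ha : Integrable (fun _ : ℝ ↦ a) (gaussianReal 0 1) := integrable_const a
  have h1 : Integrable (fun x ↦ a + b * x ^ 1) (gaussianReal 0 1) := ha.add (hi 1 b)
  have h2 : Integrable (fun x ↦ a + b * x ^ 1 + c * x ^ 2) (gaussianReal 0 1) := h1.add (hi 2 c)
  have h3 : Integrable (fun x ↦ a + b * x ^ 1 + c * x ^ 2 + p * x ^ 3) (gaussianReal 0 1) :=
    h2.add (hi 3 p)
  rw [integral_add h3 (hi 4 q), integral_add h2 (hi 3 p), integral_add h1 (hi 2 c),
    integral_add ha (hi 1 b)]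
  simp only [integral_const_mul]
  simp only [integral_pow_two_gaussianReal, gaussianReal_moments.1, gaussianReal_moments.2,
    pow_one, integral_id_gaussianReal, integral_const]
  simp
  ring

lemma integral_hermiteFun_mul (k l : Fin 3) :
    ∫ x, hermiteFun k x * hermiteFun l x ∂(gaussianReal 0 1) = if k = l then 1 else 0 := by
  have h2 : √2 ^ 2 = (2 : ℝ) := Real.sq_sqrt (by norm_num)
  have key (a b c p q : ℝ)
      (h : ∀ x, hermiteFun k x * hermiteFun l x =
        a + b * x ^ 1 + c * x ^ 2 + p * x ^ 3 + q * x ^ 4) :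
      ∫ x, hermiteFun k x * hermiteFun l x ∂(gaussianReal 0 1) = a + c + 3 * q := by
    rw [← integral_quartic_gaussianReal a b c p q]
    exact integral_congr_ae (ae_of_all _ h)
  fin_cases k <;> fin_cases l
  · rw [key 1 0 0 0 0 fun x ↦ by simp [hermiteFun]]; simp
  · rw [key 0 1 0 0 0 fun x ↦ by simp [hermiteFun]]; simp
  · rw [key (-1 / √2) 0 (1 / √2) 0 0 fun x ↦ by simp [hermiteFun]; ring]; simp; ring
  · rw [key 0 1 0 0 0 fun x ↦ by simp [hermiteFun]]; simp
  · rw [key 0 0 1 0 0 fun x ↦ by simp [hermiteFun]; ring]; simp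
  · rw [key 0 (-1 / √2) 0 (1 / √2) 0 fun x ↦ by simp [hermiteFun]; ring]; simp
  · rw [key (-1 / √2) 0 (1 / √2) 0 0 fun x ↦ by simp [hermiteFun]; ring]; simp; ring
  · rw [key 0 (-1 / √2) 0 (1 / √2) 0 fun x ↦ by simp [hermiteFun]; ring]; simp
  · rw [key (1 / 2) 0 (-1) 0 (1 / 2) fun x ↦ by
      simp only [hermiteFun, Fin.reduceFinMk, Matrix.cons_val]
      rw [div_mul_div_comm, ← sq √2, h2]; ring]
    norm_num

end GaussianMoments

/-! ### Multivariate Hermite polynomials of degree one and two -/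

section HermiteFeatures

/-- The index type of the multivariate Hermite polynomials of degree one and two in `d`
variables. -/
abbrev HermiteIndex (d : ℕ) : Type := Fin d ⊕ (Fin d ⊕ {p : Fin d × Fin d // p.1 < p.2})

lemma card_hermiteIndex (d : ℕ) : Fintype.card (HermiteIndex d) = d * (d + 3) / 2 := by
  have h : Fintype.card {p : Fin d × Fin d // p.1 < p.2} = d * (d - 1) / 2 := by
    rw [Fintype.card_subtype, Finset.card_filter, Fintype.sum_prod_type_right]
    rw [← Finset.sum_range_id, Finset.sum_range]
    refine Finset.sum_congr rfl fun j _ ↦ ?_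
    rw [← Finset.card_filter, show Finset.univ.filter (fun i ↦ i < j) = Finset.Iio j by ext; simp,
      Fin.card_Iio]
  rw [Fintype.card_sum, Fintype.card_sum, h, Fintype.card_fin]
  -- The subtraction in `d - 1` truncates, so `d = 0` is separate.
  rcases d with _ | d
  · rfl
  · rw [Nat.add_sub_cancel, show (d + 1) * (d + 1 + 3) = (d + 1) * d + 2 * (2 * (d + 1)) by ring,
      Nat.add_mul_div_left _ _ two_pos]
    ring

variable {d : ℕ}

/-- The multi-degree of the Hermite polynomial with the given index. -/
def hermiteDegree : HermiteIndex d → Fin d → Fin 3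
  | .inl i, k => if k = i then 1 else 0
  | .inr (.inl i), k => if k = i then 2 else 0
  | .inr (.inr p), k => if k = p.1.1 ∨ k = p.1.2 then 1 else 0

/-- Distinct multi-degrees give orthogonal polynomials, hence an identity covariance. -/
lemma hermiteDegree_injective : Function.Injective (hermiteDegree (d := d)) := by
  intro k l h
  have h' := congrFun h
  rcases k with i | i | ⟨⟨i, j⟩, hij⟩ <;> rcases l with k | k | ⟨⟨k, l⟩, hkl⟩ <;>
    simp only [hermiteDegree] at h'
  · have := h' i; grind
  · have := h' i; grind
  · have := h' k; have := h' l; grind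
  · have := h' i; grind
  · have := h' i; grind
  · have := h' i; grind
  · have := h' i; have := h' j; grind
  · have := h' k; grind
  · have := h' i; have := h' j; have := h' k; have := h' l; grind

/-- Gives orthogonality to the constant 1, that is, mean zero. -/
lemma hermiteDegree_ne_zero (k : HermiteIndex d) : hermiteDegree k ≠ 0 := by
  intro h
  rcases k with i | i | p
  · simpa [hermiteDegree] using congrFun h i
  · simpa [hermiteDegree] using congrFun h i
  · simpa [hermiteDegree] using congrFun h p.1.1

/-- The vector of the normalized Hermite polynomials of degree one and two. -/
noncomputable def hermiteVec (y : EuclideanSpace ℝ (Fin d)) :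
    EuclideanSpace ℝ (HermiteIndex d) :=
  WithLp.toLp 2 fun k ↦ ∏ i, hermiteFun (hermiteDegree k i) (y i)

lemma hermiteFun_zero (x : ℝ) : hermiteFun 0 x = 1 := rfl
lemma hermiteFun_one (x : ℝ) : hermiteFun 1 x = x := rfl
lemma hermiteFun_two (x : ℝ) : hermiteFun 2 x = (x ^ 2 - 1) / √2 := rfl

lemma hermiteVec_apply (y : EuclideanSpace ℝ (Fin d)) (k : HermiteIndex d) :
    hermiteVec y k = ∏ i, hermiteFun (hermiteDegree k i) (y i) := rfl

lemma hermiteVec_inl (y : EuclideanSpace ℝ (Fin d)) (i : Fin d) :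
    hermiteVec y (.inl i) = y i := by
  rw [hermiteVec_apply, Finset.prod_eq_single i]
  · simp [hermiteDegree, hermiteFun_one]
  · intro j _ hj
    simp [hermiteDegree, hj, hermiteFun_zero]
  · simp

lemma hermiteVec_diag (y : EuclideanSpace ℝ (Fin d)) (i : Fin d) :
    hermiteVec y (.inr (.inl i)) = (y i ^ 2 - 1) / √2 := by
  rw [hermiteVec_apply, Finset.prod_eq_single i]
  · simp [hermiteDegree, hermiteFun_two]
  · intro j _ hj
    simp [hermiteDegree, hj, hermiteFun_zero]
  · simp

lemma hermiteVec_offDiag (y : EuclideanSpace ℝ (Fin d)) (p : {p : Fin d × Fin d // p.1 < p.2}) :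
    hermiteVec y (.inr (.inr p)) = y p.1.1 * y p.1.2 := by
  rw [hermiteVec_apply, Finset.prod_eq_mul p.1.1 p.1.2 p.2.ne]
  · simp [hermiteDegree, hermiteFun_one]
  · intro j _ hj
    simp [hermiteDegree, hj.1, hj.2, hermiteFun_zero]
  · simp
  · simp

@[fun_prop]
lemma measurable_hermiteVec : Measurable (hermiteVec (d := d)) := by
  refine (WithLp.measurable_toLp 2 _).comp (measurable_pi_lambda _ fun k ↦ ?_)
  exact Finset.measurable_prod _ fun i _ ↦ (measurable_hermiteFun _).comp (by fun_prop)

/-- Independence of the coordinates factors the integral into one-dimensional inner products. -/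
lemma integral_prod_hermiteFun_mul (a b : Fin d → Fin 3) :
    ∫ y : EuclideanSpace ℝ (Fin d), (∏ i, hermiteFun (a i) (y i)) * ∏ i, hermiteFun (b i) (y i)
      ∂(stdGaussian (EuclideanSpace ℝ (Fin d))) = if a = b then 1 else 0 := by
  have hm (a : Fin d → Fin 3) : Measurable fun y : EuclideanSpace ℝ (Fin d) ↦
      ∏ i, hermiteFun (a i) (y i) :=
    Finset.measurable_prod _ fun i _ ↦ (measurable_hermiteFun _).comp (by fun_prop)
  have hab : Measurable fun y : EuclideanSpace ℝ (Fin d) ↦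
      (∏ i, hermiteFun (a i) (y i)) * ∏ i, hermiteFun (b i) (y i) := (hm a).mul (hm b)
  rw [← map_pi_eq_stdGaussian, integral_map (by fun_prop) hab.aestronglyMeasurable]
  simp_rw [← Finset.prod_mul_distrib]
  rw [integral_fintype_prod_eq_prod (𝕜 := ℝ) (fun i x ↦ hermiteFun (a i) x * hermiteFun (b i) x)]
  simp_rw [integral_hermiteFun_mul]
  rw [Finset.prod_ite_zero]
  simp [funext_iff]

lemma integral_hermiteVec_mul (k l : HermiteIndex d) :
    ∫ y, hermiteVec y k * hermiteVec y l ∂(stdGaussian (EuclideanSpace ℝ (Fin d))) =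
      if k = l then 1 else 0 := by
  simp_rw [hermiteVec_apply]
  rw [integral_prod_hermiteFun_mul]
  simp [hermiteDegree_injective.eq_iff]

lemma integral_hermiteVec_apply (k : HermiteIndex d) :
    ∫ y, hermiteVec y k ∂(stdGaussian (EuclideanSpace ℝ (Fin d))) = 0 := by
  have := integral_prod_hermiteFun_mul (hermiteDegree k) 0
  simpa [hermiteFun_zero, hermiteDegree_ne_zero, ← hermiteVec_apply] using this

lemma memLp_hermiteVec_apply (k : HermiteIndex d) :
    MemLp (fun y ↦ hermiteVec y k) 2 (stdGaussian (EuclideanSpace ℝ (Fin d))) := by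
  have hm : Measurable fun y : EuclideanSpace ℝ (Fin d) ↦ hermiteVec y k := by fun_prop
  refine (memLp_two_iff_integrable_sq hm.aestronglyMeasurable).2 ?_
  rw [← map_pi_eq_stdGaussian, integrable_map_measure (hm.pow_const 2).aestronglyMeasurable
    (by fun_prop)]
  simp only [Function.comp_def, hermiteVec_apply, ← Finset.prod_pow]
  exact Integrable.fintype_prod (𝕜 := ℝ) (f := fun i x ↦ hermiteFun (hermiteDegree k i) x ^ 2)
    fun i ↦ (memLp_hermiteFun _).integrable_sq

lemma memLp_hermiteVec :
    MemLp (hermiteVec (d := d)) 2 (stdGaussian (EuclideanSpace ℝ (Fin d))) :=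
  MemLp.of_eval_piLp memLp_hermiteVec_apply

lemma integral_hermiteVec :
    ∫ y, hermiteVec y ∂(stdGaussian (EuclideanSpace ℝ (Fin d))) = 0 := by
  ext k
  rw [eval_integral_piLp fun k ↦ (memLp_hermiteVec_apply k).integrable one_le_two,
    integral_hermiteVec_apply]
  rfl

/-- Orthonormality in the form the central limit theorem asks for. -/
lemma integral_inner_hermiteVec_sq (t : EuclideanSpace ℝ (HermiteIndex d)) :
    ∫ y, inner ℝ t (hermiteVec y) ^ 2 ∂(stdGaussian (EuclideanSpace ℝ (Fin d))) = ‖t‖ ^ 2 := by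
  have h (y : EuclideanSpace ℝ (Fin d)) : inner ℝ t (hermiteVec y) ^ 2 =
      ∑ k, ∑ l, t k * t l * (hermiteVec y k * hermiteVec y l) := by
    rw [sq, PiLp.inner_apply, Finset.sum_mul_sum]
    refine Finset.sum_congr rfl fun k _ ↦ Finset.sum_congr rfl fun l _ ↦ ?_
    simp
    ring
  have hi (k l : HermiteIndex d) : Integrable
      (fun y ↦ t k * t l * (hermiteVec y k * hermiteVec y l))
      (stdGaussian (EuclideanSpace ℝ (Fin d))) :=
    ((memLp_hermiteVec_apply k).integrable_mul (memLp_hermiteVec_apply l)).const_mul _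
  simp_rw [h]
  rw [integral_finsetSum _ fun k _ ↦ integrable_finsetSum _ fun l _ ↦ hi k l]
  simp_rw [integral_finsetSum _ fun l _ ↦ hi _ l, integral_const_mul, integral_hermiteVec_mul]
  rw [EuclideanSpace.real_norm_sq_eq]
  refine Finset.sum_congr rfl fun k _ ↦ ?_
  rw [Finset.sum_eq_single k]
  · simp [sq]
  · intro l _ hl
    simp [hl.symm]
  · simp

end HermiteFeatures

/-! ### Limit theorems -/

section LimitTheorems

variable {Ω : Type*} [MeasurableSpace Ω] {P : Measure Ω} [IsProbabilityMeasure P]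

/-- **Central limit theorem** in finite dimension, for centered random vectors with identity
covariance. -/
theorem tendstoInDistribution_inv_sqrt_smul_sum {E : Type*} [NormedAddCommGroup E]
    [InnerProductSpace ℝ E] [FiniteDimensional ℝ E] [MeasurableSpace E] [BorelSpace E]
    {X : ℕ → Ω → E} (hX : MemLp (X 0) 2 P)
    (h0 : ∀ t, ∫ ω, inner ℝ t (X 0 ω) ∂P = 0) (h1 : ∀ t, ∫ ω, inner ℝ t (X 0 ω) ^ 2 ∂P = ‖t‖ ^ 2)
    (hindep : iIndepFun X P) (hident : ∀ i, IdentDistrib (X i) (X 0) P P) :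
    TendstoInDistribution (fun (n : ℕ) ω ↦ (√n)⁻¹ • ∑ k ∈ Finset.range n, X k ω) atTop id
      (fun _ ↦ P) (stdGaussian E) where
  forall_aemeasurable n :=
    .const_smul (Finset.aemeasurable_fun_sum _ fun _ _ ↦ (hident _).aemeasurable_fst) _
  tendsto := by
    refine ProbabilityMeasure.tendsto_iff_tendsto_charFun.2 fun t ↦ ?_
    have hmt : Measurable fun x : E ↦ inner ℝ t x := by fun_prop
    have hXt : MemLp (fun ω ↦ inner ℝ t (X 0 ω)) 2 P := hX.const_inner t
    have hvar : Var[fun ω ↦ inner ℝ t (X 0 ω); P] = ‖t‖ ^ 2 := by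
      rw [variance_of_integral_eq_zero hXt.aemeasurable (h0 t), h1]
    have hclt := tendstoInDistribution_inv_sqrt_mul_sum_sub (P := P)
      (P' := gaussianReal 0 (‖t‖ ^ 2).toNNReal) (Y := id) (X := fun n ω ↦ inner ℝ t (X n ω))
      (by rw [hvar]; exact HasLaw.id) hXt (hindep.comp (fun _ x ↦ inner ℝ t x) fun _ ↦ hmt)
      (fun i ↦ (hident i).comp hmt)
    -- Cramér–Wold: the characteristic function of the vector at `t` is that of its projection on
    -- `t`, evaluated at 1.
    have := ProbabilityMeasure.tendsto_iff_tendsto_charFun.1 hclt.tendsto 1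
    simp only [ProbabilityMeasure.coe_mk, Measure.map_id] at this ⊢
    rw [charFun_stdGaussian]
    rw [charFun_gaussianReal] at this
    have hm (n : ℕ) : AEMeasurable (fun ω ↦ (√n)⁻¹ • ∑ k ∈ Finset.range n, X k ω) P :=
      .const_smul (Finset.aemeasurable_fun_sum _ fun _ _ ↦ (hident _).aemeasurable_fst) _
    convert this using 2 with n
    · rw [charFun_apply, charFun_apply, integral_map (hm n) (by fun_prop), integral_map
        (hclt.forall_aemeasurable n) (by fun_prop)]
      congr with ω
      rw [h0, real_inner_comm t, inner_smul_right, inner_sum]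
      simp
    · congr 1
      rw [Real.coe_toNNReal _ (by positivity)]
      push_cast
      ring

/-- Two sequences of random variables that almost surely coincide from some index on have the same
limit in distribution. -/
lemma tendstoInDistribution_congr_eventually {E Ω' : Type*} [TopologicalSpace E]
    [MeasurableSpace E] [OpensMeasurableSpace E] [MeasurableSpace Ω'] {P' : Measure Ω'}
    [IsProbabilityMeasure P'] {X Y : ℕ → Ω → E} {Z : Ω' → E}
    (hX : TendstoInDistribution X atTop Z (fun _ ↦ P) P') (hY : ∀ n, AEMeasurable (Y n) P)
    (hXY : ∀ᵐ ω ∂P, ∀ᶠ n in atTop, X n ω = Y n ω) :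
    TendstoInDistribution Y atTop Z (fun _ ↦ P) P' where
  forall_aemeasurable := hY
  aemeasurable_limit := hX.aemeasurable_limit
  tendsto := by
    have h := ProbabilityMeasure.tendsto_iff_forall_integral_tendsto.1 hX.tendsto
    refine ProbabilityMeasure.tendsto_iff_forall_integral_tendsto.2 fun f ↦ ?_
    have hXm := hX.forall_aemeasurable
    have hi {W : Ω → E} (hW : AEMeasurable W P) : Integrable (fun ω ↦ f (W ω)) P :=
      Integrable.of_bound (f.continuous.measurable.comp_aemeasurable hW).aestronglyMeasurable ‖f‖
        (ae_of_all _ fun ω ↦ f.norm_coe_le_norm _)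
    -- For bounded continuous `f` the difference is eventually zero almost surely and bounded by `2
    -- * ‖f‖`, so its integral vanishes in the limit.
    have hlim : Tendsto (fun n ↦ ∫ ω, (f (Y n ω) - f (X n ω)) ∂P) atTop (nhds 0) := by
      have := tendsto_integral_of_dominated_convergence (μ := P)
        (F := fun n ω ↦ f (Y n ω) - f (X n ω)) (f := fun _ ↦ (0 : ℝ)) (fun _ ↦ 2 * ‖f‖)
        (fun n ↦ ((hi (hY n)).sub (hi (hXm n))).aestronglyMeasurable) (integrable_const _)
        (fun n ↦ ae_of_all _ fun ω ↦ by
          refine (norm_sub_le _ _).trans ?_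
          linarith [f.norm_coe_le_norm (Y n ω), f.norm_coe_le_norm (X n ω)])
        (by
          filter_upwards [hXY] with ω hω
          refine tendsto_const_nhds.congr' ?_
          filter_upwards [hω] with n hn
          simp [hn])
      simpa using this
    have := (h f).add hlim
    rw [add_zero] at this
    refine this.congr fun n ↦ ?_
    simp only [ProbabilityMeasure.coe_mk]
    rw [integral_map (hXm n) f.continuous.measurable.aestronglyMeasurable,
      integral_map (hY n) f.continuous.measurable.aestronglyMeasurable,
      integral_sub (hi (hY n)) (hi (hXm n))]
    ring

/-- Convergence in distribution only depends on the law of the limit. -/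
lemma TendstoInDistribution.of_map_eq {E Ω' Ω'' : Type*} [TopologicalSpace E]
    [MeasurableSpace E] [OpensMeasurableSpace E] [MeasurableSpace Ω'] [MeasurableSpace Ω'']
    {P' : Measure Ω'} {P'' : Measure Ω''} [IsProbabilityMeasure P'] [IsProbabilityMeasure P'']
    {X : ℕ → Ω → E} {Z : Ω' → E} {Z' : Ω'' → E}
    (hX : TendstoInDistribution X atTop Z (fun _ ↦ P) P') (hZ' : AEMeasurable Z' P'')
    (h : P'.map Z = P''.map Z') :
    TendstoInDistribution X atTop Z' (fun _ ↦ P) P'' where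
  forall_aemeasurable := hX.forall_aemeasurable
  aemeasurable_limit := hZ'
  tendsto := by
    convert hX.tendsto using 3
    exact congrArg nhds (Subtype.ext h.symm)

/-- Reindexing coordinates is a linear isometry, which preserves both the standard Gaussian and the
norm. -/
lemma map_sum_sq_stdGaussian (ι : Type*) [Fintype ι] :
    (stdGaussian (EuclideanSpace ℝ ι)).map (fun z ↦ ∑ i, z i ^ 2) =
      chiSquare (Fintype.card ι) := by
  have e := LinearIsometryEquiv.piLpCongrLeft 2 ℝ ℝ (Fintype.equivFin ι)
  have h (κ : Type _) [Fintype κ] : (fun z : EuclideanSpace ℝ κ ↦ ∑ i, z i ^ 2) =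
      fun z ↦ ‖z‖ ^ 2 := by
    ext z; rw [EuclideanSpace.real_norm_sq_eq]
  rw [chiSquare, h ι]
  have h2 : (fun z : Fin (Fintype.card ι) → ℝ ↦ ∑ i, z i ^ 2) =
      (fun z : EuclideanSpace ℝ (Fin (Fintype.card ι)) ↦ ‖z‖ ^ 2) ∘ WithLp.toLp 2 := by
    ext z; simp [EuclideanSpace.real_norm_sq_eq]
  rw [h2, ← Measure.map_map (by fun_prop) (by fun_prop), map_pi_eq_stdGaussian,
    ← stdGaussian_map e, Measure.map_map (by fun_prop) (by fun_prop)]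
  congr 1
  ext z
  simp

end LimitTheorems

/-! ### Sample moments in Hermite coordinates -/

section SampleMoments

variable {d : ℕ}

/-- The `(i, j)` entry of the symmetric matrix encoded by the degree-two Hermite coordinates. -/
noncomputable def hermiteEntry (i j : Fin d) : StrongDual ℝ (EuclideanSpace ℝ (HermiteIndex d)) :=
  if i = j then √2 • EuclideanSpace.proj (.inr (.inl i))
  else if h : i < j then EuclideanSpace.proj (.inr (.inr ⟨(i, j), h⟩))
  else if h : j < i then EuclideanSpace.proj (.inr (.inr ⟨(j, i), h⟩))
  else 0

lemma hermiteEntry_self (i : Fin d) (x : EuclideanSpace ℝ (HermiteIndex d)) :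
    hermiteEntry i i x = √2 * x (.inr (.inl i)) := by
  simp [hermiteEntry]

lemma hermiteEntry_of_lt {i j : Fin d} (h : i < j) (x : EuclideanSpace ℝ (HermiteIndex d)) :
    hermiteEntry i j x = x (.inr (.inr ⟨(i, j), h⟩)) := by
  simp [hermiteEntry, h.ne, h]

lemma hermiteEntry_comm (i j : Fin d) : hermiteEntry i j = hermiteEntry j i := by
  rcases lt_trichotomy i j with h | rfl | h
  · simp [hermiteEntry, h, h.ne, h.ne', h.not_gt]
  · rfl
  · simp [hermiteEntry, h, h.ne, h.ne', h.not_gt]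

/-- The weight `√2` on the diagonal undoes the normalization of the second Hermite polynomial. -/
lemma hermiteEntry_hermiteVec (i j : Fin d) (y : EuclideanSpace ℝ (Fin d)) :
    hermiteEntry i j (hermiteVec y) = y i * y j - (1 : Matrix (Fin d) (Fin d) ℝ) i j := by
  have key {i j : Fin d} (h : i < j) :
      hermiteEntry i j (hermiteVec y) = y i * y j - (1 : Matrix (Fin d) (Fin d) ℝ) i j := by
    rw [hermiteEntry_of_lt h, hermiteVec_offDiag, Matrix.one_apply_ne h.ne, sub_zero]
  rcases lt_trichotomy i j with h | rfl | h
  · exact key h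
  · rw [hermiteEntry_self, hermiteVec_diag, Matrix.one_apply_eq]
    field_simp
  · rw [hermiteEntry_comm, key h, mul_comm, ← Matrix.transpose_apply (1 : Matrix _ _ ℝ),
      Matrix.transpose_one]

lemma sum_sum_eq_sum_diag_add {F : Fin d → Fin d → ℝ} (hF : ∀ i j, F i j = F j i) :
    ∑ i, ∑ j, F i j =
      ∑ i, F i i + 2 * ∑ p : {p : Fin d × Fin d // p.1 < p.2}, F p.1.1 p.1.2 := by
  have h1 : ∑ p : {p : Fin d × Fin d // p.1 < p.2}, F p.1.1 p.1.2 =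
      ∑ i, ∑ j, if i < j then F i j else 0 := by
    rw [← Finset.sum_subtype (Finset.univ.filter fun p : Fin d × Fin d ↦ p.1 < p.2) (by simp)
      (fun p ↦ F p.1 p.2), Finset.sum_filter, Fintype.sum_prod_type]
  have h2 : ∑ i, ∑ j, (if j < i then F i j else 0) = ∑ i, ∑ j, if i < j then F i j else 0 := by
    rw [Finset.sum_comm]
    simp_rw [hF]
  have h3 : ∑ i, F i i = ∑ i, ∑ j, if i = j then F i j else 0 := by simp
  rw [two_mul, h1]
  nth_rw 2 [← h2]
  rw [h3]
  simp_rw [← Finset.sum_add_distrib]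
  refine Finset.sum_congr rfl fun i _ ↦ Finset.sum_congr rfl fun j _ ↦ ?_
  rcases lt_trichotomy i j with h | rfl | h
  · simp [h, h.ne, h.not_gt]
  · simp
  · simp [h, h.ne', h.not_gt]

/-- Diagonal entries carry `√2` squared and off-diagonal ones occur twice; halving gives every
coordinate weight one. -/
lemma sum_sq_hermiteIndex (x : EuclideanSpace ℝ (HermiteIndex d)) :
    ∑ k, x k ^ 2 = ∑ i, x (.inl i) ^ 2 + (∑ i, ∑ j, hermiteEntry i j x ^ 2) / 2 := by
  rw [sum_sum_eq_sum_diag_add fun i j ↦ by rw [hermiteEntry_comm]]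
  simp_rw [hermiteEntry_self, mul_pow, Real.sq_sqrt zero_le_two, ← Finset.mul_sum]
  rw [Fintype.sum_sum_type, Fintype.sum_sum_type]
  have : ∀ p : {p : Fin d × Fin d // p.1 < p.2},
    hermiteEntry p.1.1 p.1.2 x = x (.inr (.inr p)) := fun p ↦ hermiteEntry_of_lt p.2 x
  simp_rw [this]
  ring

/-- The sample mean as a function of the averaged Hermite coordinates. -/
noncomputable def hermiteMean (x : EuclideanSpace ℝ (HermiteIndex d)) : EuclideanSpace ℝ (Fin d) :=
  WithLp.toLp 2 fun i ↦ x (.inl i)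

/-- The deviation of the sample covariance from the identity as a function of the averaged Hermite
coordinates. -/
noncomputable def hermiteCovSubOne (x : EuclideanSpace ℝ (HermiteIndex d)) :
    Matrix (Fin d) (Fin d) ℝ :=
  Matrix.of fun i j ↦ hermiteEntry i j x - x (.inl i) * x (.inl j)

lemma isSymm_hermiteCovSubOne (x : EuclideanSpace ℝ (HermiteIndex d)) :
    (hermiteCovSubOne x).IsSymm := by
  ext i j
  simp [hermiteCovSubOne, hermiteEntry_comm i j, mul_comm]

lemma continuous_hermiteCovSubOne : Continuous (hermiteCovSubOne (d := d)) := by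
  refine continuous_matrix fun i j ↦ ?_
  simp only [hermiteCovSubOne, Matrix.of_apply]
  fun_prop

/-- The average of the Hermite coordinates of the first `n` points. -/
noncomputable def hermiteAvg (n : ℕ) (y : ℕ → EuclideanSpace ℝ (Fin d)) :
    EuclideanSpace ℝ (HermiteIndex d) :=
  (n : ℝ)⁻¹ • ∑ t ∈ Finset.range n, hermiteVec (y t)

lemma sampleMean_eq_hermiteMean (n : ℕ) (y : ℕ → EuclideanSpace ℝ (Fin d)) :
    sampleMean n y = hermiteMean (hermiteAvg n y) := by
  ext i
  simp [sampleMean, hermiteMean, hermiteAvg, hermiteVec_inl]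

lemma sampleCov_apply {n : ℕ} (hn : n ≠ 0) (y : ℕ → EuclideanSpace ℝ (Fin d)) (i j : Fin d) :
    sampleCov n y i j = (n : ℝ)⁻¹ * ∑ t ∈ Finset.range n, y t i * y t j -
      sampleMean n y i * sampleMean n y j := by
  have hm (i : Fin d) : sampleMean n y i = (n : ℝ)⁻¹ * ∑ t ∈ Finset.range n, y t i := by
    simp [sampleMean]
  have h : sampleCov n y i j = (n : ℝ)⁻¹ * ∑ t ∈ Finset.range n,
      (y t i - sampleMean n y i) * (y t j - sampleMean n y j) := by
    simp [sampleCov, Matrix.sum_apply, Matrix.vecMulVec_apply]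
  rw [h]
  have hs : ∀ t, (y t i - sampleMean n y i) * (y t j - sampleMean n y j) =
      y t i * y t j - sampleMean n y i * y t j - sampleMean n y j * y t i +
        sampleMean n y i * sampleMean n y j := fun t ↦ by ring
  simp_rw [hs, Finset.sum_add_distrib, Finset.sum_sub_distrib, ← Finset.mul_sum]
  rw [Finset.sum_const, Finset.card_range, nsmul_eq_mul]
  have hn' : (n : ℝ) ≠ 0 := by exact_mod_cast hn
  have hi : ∑ t ∈ Finset.range n, y t i = n * sampleMean n y i := by rw [hm]; field_simp
  have hj : ∑ t ∈ Finset.range n, y t j = n * sampleMean n y j := by rw [hm]; field_simp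
  rw [hi, hj]
  field_simp
  ring

/-- The case `n = 0` must be excluded: for `d > 0` the sample covariance is then 0 while the right
side is the identity. -/
lemma sampleCov_eq_one_add {n : ℕ} (hn : n ≠ 0) (y : ℕ → EuclideanSpace ℝ (Fin d)) :
    sampleCov n y = 1 + hermiteCovSubOne (hermiteAvg n y) := by
  ext i j
  have hn' : (n : ℝ) ≠ 0 := by exact_mod_cast hn
  have hmean (i : Fin d) : hermiteAvg n y (.inl i) = sampleMean n y i := by
    rw [sampleMean_eq_hermiteMean]; rfl
  rw [sampleCov_apply hn, Matrix.add_apply, hermiteCovSubOne, Matrix.of_apply, hmean, hmean,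
    hermiteAvg, map_smul, map_sum]
  simp_rw [hermiteEntry_hermiteVec]
  rw [Finset.sum_sub_distrib, Finset.sum_const, Finset.card_range, nsmul_eq_mul, smul_eq_mul,
    mul_sub, inv_mul_cancel_left₀ hn']
  ring

lemma posSemidef_sampleCov (n : ℕ) (y : ℕ → EuclideanSpace ℝ (Fin d)) :
    (sampleCov n y).PosSemidef := by
  refine Matrix.PosSemidef.smul (Matrix.posSemidef_sum _ fun t _ ↦ ?_) (by positivity)
  simpa using Matrix.posSemidef_vecMulVec_self_star (y t - sampleMean n y).ofLp

end SampleMoments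

/-! ### Affine equivariance -/

section Whitening

variable {d : ℕ}

lemma sampleMean_affine {n : ℕ} (hn : n ≠ 0) (a : EuclideanSpace ℝ (Fin d))
    (B : Matrix (Fin d) (Fin d) ℝ) (y : ℕ → EuclideanSpace ℝ (Fin d)) :
    sampleMean n (fun t ↦ a + Matrix.toEuclideanCLM (𝕜 := ℝ) B (y t)) =
      a + Matrix.toEuclideanCLM (𝕜 := ℝ) B (sampleMean n y) := by
  have hn' : (n : ℝ) ≠ 0 := by exact_mod_cast hn
  simp only [sampleMean, Finset.sum_add_distrib, map_smul, map_sum, smul_add, Finset.sum_const,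
    Finset.card_range]
  rw [← Nat.cast_smul_eq_nsmul ℝ, inv_smul_smul₀ hn']

lemma sampleCov_affine {n : ℕ} (hn : n ≠ 0) (a : EuclideanSpace ℝ (Fin d))
    (B : Matrix (Fin d) (Fin d) ℝ) (y : ℕ → EuclideanSpace ℝ (Fin d)) :
    sampleCov n (fun t ↦ a + Matrix.toEuclideanCLM (𝕜 := ℝ) B (y t)) =
      B * sampleCov n y * B.transpose := by
  simp only [sampleCov, sampleMean_affine hn, add_sub_add_left_eq_sub, ← map_sub,
    Matrix.ofLp_toEuclideanCLM, Matrix.mul_smul, Matrix.smul_mul, Matrix.mul_sum, Matrix.sum_mul]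
  congr 1
  refine Finset.sum_congr rfl fun t _ ↦ ?_
  rw [Matrix.mul_vecMulVec, Matrix.vecMulVec_mul, Matrix.vecMul_transpose]

/-- `B` times the root of `C` need not be the root of `B * C * B.transpose`, so the two laws are
compared through characteristic functions. -/
lemma map_affine_multivariateGaussian {ι : Type*} [Fintype ι] [DecidableEq ι]
    (m a : EuclideanSpace ℝ ι) {B C : Matrix ι ι ℝ} (hC : C.PosSemidef) :
    (multivariateGaussian a C).map (fun x ↦ m + Matrix.toEuclideanCLM (𝕜 := ℝ) B x) =
      multivariateGaussian (m + Matrix.toEuclideanCLM (𝕜 := ℝ) B a) (B * C * B.transpose) := by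
  have hBC : (B * C * B.transpose).PosSemidef := by
    simpa [Matrix.conjTranspose_eq_transpose_of_trivial] using hC.mul_mul_conjTranspose_same B
  have hm : Measurable fun x ↦ m + Matrix.toEuclideanCLM (𝕜 := ℝ) B x := by fun_prop
  refine Measure.ext_of_charFun (funext fun t ↦ ?_)
  -- The adjoint of `B` moves the frequency `t` to `s`.
  let s : EuclideanSpace ℝ ι := WithLp.toLp 2 (B.transpose.mulVec t.ofLp)
  have hin (x : EuclideanSpace ℝ ι) : inner ℝ (Matrix.toEuclideanCLM (𝕜 := ℝ) B x) t =
      inner ℝ x s := by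
    rw [real_inner_comm, Matrix.inner_toEuclideanCLM, Matrix.dotProduct_mulVec,
      EuclideanSpace.inner_eq_star_dotProduct]
    simp [s, Matrix.mulVec_transpose]
  have h1 : charFun ((multivariateGaussian a C).map
      (fun x ↦ m + Matrix.toEuclideanCLM (𝕜 := ℝ) B x)) t =
      Complex.exp (inner ℝ m t * Complex.I) * charFun (multivariateGaussian a C) s := by
    rw [charFun_apply, charFun_apply, integral_map hm.aemeasurable (by fun_prop),
      ← integral_const_mul]
    congr with x
    rw [inner_add_left, hin, ← Complex.exp_add]
    push_cast
    ring_nf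
  rw [h1, charFun_multivariateGaussian hC, charFun_multivariateGaussian hBC, ← Complex.exp_add]
  have hmean : inner ℝ t (m + Matrix.toEuclideanCLM (𝕜 := ℝ) B a) =
      inner ℝ m t + inner ℝ s a := by
    rw [real_inner_comm, inner_add_left, hin, real_inner_comm s a]
  have : s.ofLp ⬝ᵥ C.mulVec s.ofLp = t.ofLp ⬝ᵥ (B * C * B.transpose).mulVec t.ofLp := by
    simp only [s]
    rw [← Matrix.mulVec_mulVec, ← Matrix.mulVec_mulVec, Matrix.dotProduct_mulVec t.ofLp B,
      Matrix.mulVec_transpose]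
  rw [hmean, this]
  push_cast
  ring_nf

end Whitening

/-! ### The divergence as a function of the averaged Hermite coordinates -/

section KLStatistic

variable {d : ℕ}

/-- The Kullback-Leibler divergence of the fitted Gaussian from the standard Gaussian as a function
of the averaged Hermite coordinates. -/
noncomputable def hermiteKL (x : EuclideanSpace ℝ (HermiteIndex d)) : ℝ≥0∞ :=
  if (1 + hermiteCovSubOne x).det = 0 then ∞
  else ENNReal.ofReal ((‖hermiteMean x‖ ^ 2 +
    ((hermiteCovSubOne x).trace - Real.log (1 + hermiteCovSubOne x).det)) / 2)

lemma continuous_hermiteMean : Continuous (hermiteMean (d := d)) :=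
  (PiLp.continuous_toLp 2 _).comp (by fun_prop)

lemma continuous_det_one_add_hermiteCovSubOne :
    Continuous fun x : EuclideanSpace ℝ (HermiteIndex d) ↦ (1 + hermiteCovSubOne x).det :=
  (continuous_const.add continuous_hermiteCovSubOne).matrix_det

lemma continuous_trace_hermiteCovSubOne :
    Continuous fun x : EuclideanSpace ℝ (HermiteIndex d) ↦ (hermiteCovSubOne x).trace :=
  continuous_hermiteCovSubOne.matrix_trace

lemma measurable_hermiteKL : Measurable (hermiteKL (d := d)) := by
  have hdet := (continuous_det_one_add_hermiteCovSubOne (d := d)).measurable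
  have htr := (continuous_trace_hermiteCovSubOne (d := d)).measurable
  have hmean := (continuous_hermiteMean (d := d)).measurable
  refine Measurable.ite (hdet (measurableSet_singleton 0)) measurable_const ?_
  exact (((hmean.norm.pow_const 2).add (htr.sub hdet.log)).div_const 2).ennreal_ofReal

lemma klDiv_sample_stdGaussian {n : ℕ} (hn : n ≠ 0) (y : ℕ → EuclideanSpace ℝ (Fin d)) :
    klDiv (multivariateGaussian (sampleMean n y) (sampleCov n y))
      (stdGaussian (EuclideanSpace ℝ (Fin d))) = hermiteKL (hermiteAvg n y) := by
  have hps := posSemidef_sampleCov n y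
  unfold hermiteKL
  rw [← sampleCov_eq_one_add hn]
  split_ifs with h
  · exact klDiv_multivariateGaussian_stdGaussian_of_det_eq_zero _ hps h
  · rw [klDiv_multivariateGaussian_stdGaussian _ hps h, sampleMean_eq_hermiteMean]
    nth_rw 1 [sampleCov_eq_one_add hn]
    rw [Matrix.trace_add, Matrix.trace_one, add_sub_cancel_left]

open scoped MatrixOrder in
/-- Every nondegenerate Gaussian distribution is the image of the standard one under an affine
equivalence, which preserves the Kullback-Leibler divergence of the fitted Gaussian. -/
lemma exists_map_stdGaussian_eq (m : EuclideanSpace ℝ (Fin d))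
    {S : Matrix (Fin d) (Fin d) ℝ} (hS : S.PosDef) :
    ∃ e : EuclideanSpace ℝ (Fin d) ≃ᵐ EuclideanSpace ℝ (Fin d),
      (stdGaussian (EuclideanSpace ℝ (Fin d))).map e = multivariateGaussian m S ∧
      ∀ n ≠ 0, ∀ y : ℕ → EuclideanSpace ℝ (Fin d),
        klDiv (multivariateGaussian (sampleMean n fun t ↦ e (y t)) (sampleCov n fun t ↦ e (y t)))
          (multivariateGaussian m S) = hermiteKL (hermiteAvg n y) := by
  have hB : (CFC.sqrt S).det ≠ 0 := by
    intro h
    have := hS.det_pos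
    rw [← sq_det_sqrt hS.posSemidef, h] at this
    simp at this
  -- With `B` the root of `S`, the image law is `multivariateGaussian m S` by definition.
  refine ⟨affineMeasurableEquiv m (CFC.sqrt S) hB, rfl, fun n hn y ↦ ?_⟩
  change klDiv (multivariateGaussian
        (sampleMean n fun t ↦ m + Matrix.toEuclideanCLM (𝕜 := ℝ) (CFC.sqrt S) (y t))
        (sampleCov n fun t ↦ m + Matrix.toEuclideanCLM (𝕜 := ℝ) (CFC.sqrt S) (y t)))
      (multivariateGaussian m S) = _
  -- The Gaussian fitted to the transformed data is the image of the one fitted to `y`, so both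
  -- arguments are images under one equivalence.
  rw [sampleMean_affine hn, sampleCov_affine hn,
    ← map_affine_multivariateGaussian m _ (posSemidef_sampleCov n y), ← klDiv_sample_stdGaussian hn]
  exact klDiv_map_measurableEquiv _ _ (affineMeasurableEquiv m (CFC.sqrt S) hB)

lemma sqrt_smul_hermiteAvg (n : ℕ) (y : ℕ → EuclideanSpace ℝ (Fin d)) :
    √n • hermiteAvg n y = (√n)⁻¹ • ∑ t ∈ Finset.range n, hermiteVec (y t) := by
  rw [hermiteAvg, smul_smul, ← div_eq_mul_inv, Real.sqrt_div_self', one_div]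

/-- The quadratic statistic approximating twice `n` times the Kullback-Leibler divergence. -/
noncomputable def quadraticStatistic
    (p : EuclideanSpace ℝ (HermiteIndex d) × (EuclideanSpace ℝ (HermiteIndex d) × ℝ)) : ℝ :=
  ∑ i, p.1 (.inl i) ^ 2 +
    (∑ i, ∑ j, (hermiteEntry i j p.1 - p.1 (.inl i) * p.2.1 (.inl j)) ^ 2) * (1 + p.2.2) / 2

lemma continuous_quadraticStatistic : Continuous (quadraticStatistic (d := d)) := by
  unfold quadraticStatistic; fun_prop

lemma quadraticStatistic_zero (x : EuclideanSpace ℝ (HermiteIndex d)) :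
    quadraticStatistic (x, (0, 0)) = ∑ k, x k ^ 2 := by
  rw [sum_sq_hermiteIndex]
  simp [quadraticStatistic]

/-- Each square absorbs `n` as `√n` inside it. In the product of means only one factor is rescaled;
the other stays small and makes the correction negligible. -/
lemma natCast_mul_hermiteKL (n : ℕ) {x : EuclideanSpace ℝ (HermiteIndex d)}
    (hx : (1 + hermiteCovSubOne x).det ≠ 0) :
    n * hermiteKL x =
      ENNReal.ofReal (quadraticStatistic (√n • x, (x, logDetError (hermiteCovSubOne x))) / 2) := by
  have hn : √(n : ℝ) ^ 2 = n := Real.sq_sqrt (Nat.cast_nonneg n)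
  rw [hermiteKL, if_neg hx, ← ENNReal.ofReal_natCast, ← ENNReal.ofReal_mul (Nat.cast_nonneg n),
    trace_sub_log_det_eq]
  congr 1
  have h1 : ∑ i, (√(n : ℝ) • x) (.inl i) ^ 2 = n * ‖hermiteMean x‖ ^ 2 := by
    simp [EuclideanSpace.real_norm_sq_eq, hermiteMean, mul_pow, hn, Finset.mul_sum]
  have h2 : ∑ i, ∑ j, (hermiteEntry i j (√(n : ℝ) • x) -
      (√(n : ℝ) • x) (.inl i) * x (.inl j)) ^ 2 = n * ∑ i, ∑ j, hermiteCovSubOne x i j ^ 2 := by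
    simp_rw [Finset.mul_sum]
    refine Finset.sum_congr rfl fun i _ ↦ Finset.sum_congr rfl fun j _ ↦ ?_
    simp only [map_smul, smul_eq_mul, PiLp.smul_apply, hermiteCovSubOne, Matrix.of_apply]
    linear_combination (hermiteEntry i j x - x (.inl i) * x (.inl j)) ^ 2 * hn
  simp only [quadraticStatistic]
  rw [h1, h2]
  ring

lemma tendsto_frobenius_hermiteCovSubOne :
    Tendsto (fun x : EuclideanSpace ℝ (HermiteIndex d) ↦ ∑ i, ∑ j, hermiteCovSubOne x i j ^ 2)
      (nhds 0) (nhds 0) := by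
  have h : Continuous fun x : EuclideanSpace ℝ (HermiteIndex d) ↦
      ∑ i, ∑ j, hermiteCovSubOne x i j ^ 2 := by
    simp only [hermiteCovSubOne, Matrix.of_apply]
    fun_prop
  simpa [hermiteCovSubOne] using h.tendsto 0

lemma eventually_frobenius_hermiteCovSubOne_le :
    ∀ᶠ x : EuclideanSpace ℝ (HermiteIndex d) in nhds 0,
      ∑ i, ∑ j, hermiteCovSubOne x i j ^ 2 ≤ 1 / 4 :=
  tendsto_frobenius_hermiteCovSubOne.eventually_le_const (by norm_num)

lemma tendsto_logDetError_hermiteCovSubOne :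
    Tendsto (fun x : EuclideanSpace ℝ (HermiteIndex d) ↦ logDetError (hermiteCovSubOne x))
      (nhds 0) (nhds 0) := by
  refine squeeze_zero_norm' (a := fun x ↦ 4 * √(∑ i, ∑ j, hermiteCovSubOne x i j ^ 2)) ?_ ?_
  · filter_upwards [eventually_frobenius_hermiteCovSubOne_le] with x hx
    exact abs_logDetError_le (isSymm_hermiteCovSubOne x) hx
  · simpa using (tendsto_frobenius_hermiteCovSubOne (d := d)).sqrt.const_mul 4

lemma measurable_logDetError_hermiteCovSubOne :
    Measurable fun x : EuclideanSpace ℝ (HermiteIndex d) ↦ logDetError (hermiteCovSubOne x) := by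
  have hdet := (continuous_det_one_add_hermiteCovSubOne (d := d)).measurable
  have htr := (continuous_trace_hermiteCovSubOne (d := d)).measurable
  have hQ : Measurable fun x : EuclideanSpace ℝ (HermiteIndex d) ↦
      ∑ i, ∑ j, hermiteCovSubOne x i j ^ 2 := by
    simp only [hermiteCovSubOne, Matrix.of_apply]
    fun_prop
  refine Measurable.ite (hQ (measurableSet_singleton 0)) measurable_const ?_
  exact (((htr.sub hdet.log).const_mul 2).div hQ).sub_const 1

end KLStatistic

/-! ### The limit law for standard Gaussian data -/

section LimitOfDivergence

variable {Ω : Type*} [MeasurableSpace Ω] {P : Measure Ω} {d : ℕ}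
  {Y : ℕ → Ω → EuclideanSpace ℝ (Fin d)}

lemma memLp_hermiteVec_comp {X : Ω → EuclideanSpace ℝ (Fin d)}
    (hX : HasLaw X (stdGaussian (EuclideanSpace ℝ (Fin d))) P) :
    MemLp (fun ω ↦ hermiteVec (X ω)) 2 P := by
  have h := memLp_hermiteVec (d := d)
  rw [← hX.map_eq] at h
  exact h.comp_of_map hX.aemeasurable

variable [IsProbabilityMeasure P]

lemma tendsto_hermiteAvg (hlaw : ∀ t, HasLaw (Y t) (stdGaussian (EuclideanSpace ℝ (Fin d))) P)
    (hindep : iIndepFun Y P) :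
    ∀ᵐ ω ∂P, Tendsto (fun n ↦ hermiteAvg n fun t ↦ Y t ω) atTop (nhds 0) := by
  have hint : Integrable (fun ω ↦ hermiteVec (Y 0 ω)) P :=
    (memLp_hermiteVec_comp (hlaw 0)).integrable one_le_two
  have h := strong_law_ae (fun n ω ↦ hermiteVec (Y n ω)) hint
    (fun i j hij ↦ (hindep.indepFun hij).comp measurable_hermiteVec measurable_hermiteVec)
    (fun i ↦ ((hlaw i).identDistrib (hlaw 0)).comp measurable_hermiteVec)
  have h0 : ∫ ω, hermiteVec (Y 0 ω) ∂P = 0 := by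
    rw [← integral_hermiteVec]
    exact (hlaw 0).integral_comp measurable_hermiteVec.aestronglyMeasurable
  rw [h0] at h
  exact h

lemma tendstoInDistribution_sqrt_smul_hermiteAvg
    (hlaw : ∀ t, HasLaw (Y t) (stdGaussian (EuclideanSpace ℝ (Fin d))) P)
    (hindep : iIndepFun Y P) :
    TendstoInDistribution (fun (n : ℕ) ω ↦ √n • hermiteAvg n fun t ↦ Y t ω) atTop id
      (fun _ ↦ P) (stdGaussian (EuclideanSpace ℝ (HermiteIndex d))) := by
  have hm := measurable_hermiteVec (d := d)
  have h := tendstoInDistribution_inv_sqrt_smul_sum (P := P) (X := fun n ω ↦ hermiteVec (Y n ω))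
    (memLp_hermiteVec_comp (hlaw 0)) (fun t ↦ by
      have := (hlaw 0).integral_comp (f := fun y ↦ inner ℝ t (hermiteVec y)) (by fun_prop)
      refine this.trans ?_
      rw [integral_inner (memLp_hermiteVec.integrable one_le_two), integral_hermiteVec,
        inner_zero_right])
    (fun t ↦ by
      rw [← integral_inner_hermiteVec_sq t]
      exact (hlaw 0).integral_comp (f := fun y ↦ inner ℝ t (hermiteVec y) ^ 2) (by fun_prop))
    (hindep.comp (fun _ ↦ hermiteVec) fun _ ↦ hm)
    (fun i ↦ ((hlaw i).identDistrib (hlaw 0)).comp hm)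
  simp_rw [sqrt_smul_hermiteAvg]
  exact h

lemma tendstoInDistribution_hermiteKL
    (hlaw : ∀ t, HasLaw (Y t) (stdGaussian (EuclideanSpace ℝ (Fin d))) P)
    (hindep : iIndepFun Y P) :
    TendstoInDistribution (fun (n : ℕ) ω ↦ (n : ℝ≥0∞) * hermiteKL (hermiteAvg n fun t ↦ Y t ω))
      atTop (fun y : ℝ ↦ ENNReal.ofReal (y / 2)) (fun _ ↦ P) (chiSquare (d * (d + 3) / 2)) := by
  have hclt := tendstoInDistribution_sqrt_smul_hermiteAvg hlaw hindep
  have hslln := tendsto_hermiteAvg hlaw hindep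
  have hAvg (n : ℕ) : AEMeasurable (fun ω ↦ hermiteAvg n fun t ↦ Y t ω) P := by
    have (t : ℕ) : AEMeasurable (fun ω ↦ hermiteVec (Y t ω)) P :=
      measurable_hermiteVec.comp_aemeasurable (hlaw t).aemeasurable
    unfold hermiteAvg
    fun_prop
  -- The components that tend to a constant, as Slutsky's theorem requires.
  let R : ℕ → Ω → EuclideanSpace ℝ (HermiteIndex d) × ℝ := fun n ω ↦
    (hermiteAvg n fun t ↦ Y t ω, logDetError (hermiteCovSubOne (hermiteAvg n fun t ↦ Y t ω)))
  have hR (n : ℕ) : AEMeasurable (R n) P :=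
    (hAvg n).prodMk (measurable_logDetError_hermiteCovSubOne.comp_aemeasurable (hAvg n))
  have hR0 : TendstoInMeasure P R atTop fun _ ↦ (0, 0) := by
    refine tendstoInMeasure_of_tendsto_ae (fun n ↦ (hR n).aestronglyMeasurable) ?_
    filter_upwards [hslln] with ω hω
    exact hω.prodMk_nhds (tendsto_logDetError_hermiteCovSubOne.comp hω)
  have hg : Continuous fun p ↦ ENNReal.ofReal (quadraticStatistic (d := d) p / 2) :=
    ENNReal.continuous_ofReal.comp (continuous_quadraticStatistic.div_const 2)
  have hslutsky := hclt.continuous_comp_prodMk_of_tendstoInMeasure_const hg hR0 hR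
  -- The quadratic form equals the statistic only when the determinant is nonzero; near 0 it is
  -- positive, and the average almost surely gets there.
  have hlim := tendstoInDistribution_congr_eventually
    (Y := fun n ω ↦ (n : ℝ≥0∞) * hermiteKL (hermiteAvg n fun t ↦ Y t ω)) hslutsky
    (fun n ↦ (measurable_hermiteKL.comp_aemeasurable (hAvg n)).const_mul _) (by
    filter_upwards [hslln] with ω hω
    filter_upwards [hω.eventually eventually_frobenius_hermiteCovSubOne_le] with n hn
    exact (natCast_mul_hermiteKL n
      (abs_trace_sub_log_det_sub_le (isSymm_hermiteCovSubOne _) hn).1.ne').symm)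
  refine TendstoInDistribution.of_map_eq hlim (by fun_prop) ?_
  simp only [id, quadraticStatistic_zero]
  rw [← card_hermiteIndex, ← map_sum_sq_stdGaussian, Measure.map_map (by fun_prop) (by fun_prop)]
  rfl

end LimitOfDivergence

/-! ### General mean and covariance -/

theorem corollary1 {Ω : Type*} [MeasurableSpace Ω] (P : Measure Ω) [IsProbabilityMeasure P]
    (d : ℕ) (m : EuclideanSpace ℝ (Fin d)) (S : Matrix (Fin d) (Fin d) ℝ) (hS : S.PosDef)
    (ξ : ℕ → Ω → EuclideanSpace ℝ (Fin d))
    (hlaw : ∀ t, HasLaw (ξ t) (multivariateGaussian m S) P)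
    (hindep : iIndepFun ξ P) :
    TendstoInDistribution
      (fun (n : ℕ) (ω : Ω) ↦ (n : ℝ≥0∞) *
        klDiv (multivariateGaussian (sampleMean n fun t ↦ ξ t ω) (sampleCov n fun t ↦ ξ t ω))
          (multivariateGaussian m S))
      atTop (fun y : ℝ ↦ ENNReal.ofReal (y / 2)) (fun _ ↦ P)
      (chiSquare (d * (d + 3) / 2)) := by
  obtain ⟨e, he_map, he_kl⟩ := exists_map_stdGaussian_eq m hS
  have he : HasLaw e.symm (stdGaussian (EuclideanSpace ℝ (Fin d))) (multivariateGaussian m S) :=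
    ⟨e.symm.measurable.aemeasurable, by rw [← he_map, e.map_symm_map]⟩
  have h := tendstoInDistribution_hermiteKL (fun t ↦ he.comp (hlaw t))
    (hindep.comp (fun _ ↦ e.symm) fun _ ↦ e.symm.measurable)
  convert h using 3 with n ω
  -- At `n = 0` both sides vanish, since `0 * ∞ = 0`.
  rcases eq_or_ne n 0 with rfl | hn
  · simp
  · rw [← he_kl n hn]
    simp
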